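/- THEOREM 7.1. Let $S_1^3$ be the upper half-space model of the de Sitter 3-space, i.e. $\mathbb R^3_+=\{(x_1,x_2,x_3): x_3>0\}$ with the Lorentz metric $\langle\cdot,\cdot\rangle = x_3^{-2}(dx_1^2+dx_2^2-dx_3^2)$. Identify $\mathbb R^3_+$ with the Lie group whose multiplication is $(a_1,a_2,a_3)\cdot(y_1,y_2,y_3)=(a_3y_1+a_1,\,a_3y_2+a_2,\,a_3y_3)$, with identity $e=(0,0,1)$; the metric is left-invariant, and at $e$ it is $dx_1^2+dx_2^2-dx_3^2$. Let $M$ be a smooth surface and $x:M\to S_1^3$ a smooth time-like immersion, i.e. the induced metric $\mathrm I=\langle dx,dx\rangle$ on $M$ is Lorentzian, and let $N=\sum_{A=1}^{3} x_3\eta_A\,\partial/\partial x_A$, with $\eta_1^2+\eta_2^2-\eta_3^2=1$, be a smooth space-like unit normal vector field along $x$. Let $\mathrm{II}(v,w)=-\langle\nabla_vN,dx(w)\rangle$ be the second fundamental form, where $\nabla$ is the Levi-Civita connection of $S_1^3$, and let $K$ be the Gauss curvature of $(M,\mathrm I)$. Let $\widetilde N=(\eta_1,\eta_2,\eta_3):M\to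 T_eS_1^3$ be the normal Gauss map, i.e. $N$ left-translated to $T_eS_1^3$, and let $\mathrm{IV}=\langle d\widetilde N,d\widetilde N\rangle$ be the fourth fundamental form, the scalar product being that of $T_eS_1^3$. The normal Gauss map is called conformal if $\mathrm{IV}=\rho\,\mathrm{II}$ on $M$ for some smooth function $\rho:M\to\mathbb R$. Suppose that $x$ has no umbilics, i.e. at no point of $M$ is $\mathrm{II}$ a real multiple of $\mathrm I$. Then the normal Gauss map of $x$ is conformal if and only if $K=1+\eta_3^2$ at every point of $M$. -/

import Mathlib

open scoped Manifold ContDiff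

namespace DeSitter

noncomputable section

/-! ### Christoffel symbols and Gauss curvature of a metric given in coordinates -/

/-- The partial derivative `∂_i f` of a real function of `n` coordinates. -/
def partialDeriv {n : ℕ} (i : Fin n) (f : EuclideanSpace ℝ (Fin n) → ℝ)
    (u : EuclideanSpace ℝ (Fin n)) : ℝ :=
  fderiv ℝ f u (EuclideanSpace.single i 1)

/-- Christoffel symbols `Γ^k_{ij} = ½ g^{kl} (∂_i g_{jl} + ∂_j g_{il} - ∂_l g_{ij})` of the
Levi-Civita connection of the pseudo-Riemannian metric with coefficients `g_{ij}`. -/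
def christoffel {n : ℕ} (g : EuclideanSpace ℝ (Fin n) → Matrix (Fin n) (Fin n) ℝ)
    (k i j : Fin n) (u : EuclideanSpace ℝ (Fin n)) : ℝ :=
  (1 / 2) * ∑ l, (g u)⁻¹ k l *
    (partialDeriv i (fun z => g z j l) u + partialDeriv j (fun z => g z i l) u
      - partialDeriv l (fun z => g z i j) u)

/-- Coefficients `R^l_{kij}` of the curvature tensor
`R(X, Y) Z = ∇_X ∇_Y Z - ∇_Y ∇_X Z - ∇_{[X, Y]} Z`, that is,
`R(∂_i, ∂_j) ∂_k = ∑ l, R^l_{kij} ∂_l`. -/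
def riemann {n : ℕ} (g : EuclideanSpace ℝ (Fin n) → Matrix (Fin n) (Fin n) ℝ)
    (l k i j : Fin n) (u : EuclideanSpace ℝ (Fin n)) : ℝ :=
  partialDeriv i (christoffel g l j k) u - partialDeriv j (christoffel g l i k) u
    + ∑ m, (christoffel g l i m u * christoffel g m j k u
        - christoffel g l j m u * christoffel g m i k u)

/-- The (intrinsic) Gauss curvature of a two-dimensional metric with coefficients `g_{ij}`:
`K = ⟨R(∂_0, ∂_1) ∂_1, ∂_0⟩ / (g_{00} g_{11} - g_{01}²)`. -/
def gaussCurvatureCoord (g : EuclideanSpace ℝ (Fin 2) → Matrix (Fin 2) (Fin 2) ℝ)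
    (u : EuclideanSpace ℝ (Fin 2)) : ℝ :=
  (∑ l, g u 0 l * riemann g l 1 0 1 u) / (g u 0 0 * g u 1 1 - g u 0 1 ^ 2)

/-! ### The upper half-space model of the de Sitter space -/

/-- The Lorentz-Minkowski scalar product `v₁w₁ + v₂w₂ - v₃w₃` of `L³`. -/
def minkowski (v w : EuclideanSpace ℝ (Fin 3)) : ℝ :=
  v 0 * w 0 + v 1 * w 1 - v 2 * w 2

/-- The half-space `x₃ > 0`. -/
def upperHalfSpace : Set (EuclideanSpace ℝ (Fin 3)) := {y | 0 < y 2}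

/-- The de Sitter metric `(dx₁² + dx₂² - dx₃²) / x₃²` at the point `y` of the half-space. -/
def metric (y v w : EuclideanSpace ℝ (Fin 3)) : ℝ := minkowski v w / (y 2) ^ 2

/-- Coefficients of the de Sitter metric in the coordinates `x₁, x₂, x₃`. -/
def metricCoeff (y : EuclideanSpace ℝ (Fin 3)) : Matrix (Fin 3) (Fin 3) ℝ :=
  Matrix.of fun i j => metric y (EuclideanSpace.single i 1) (EuclideanSpace.single j 1)

/-- The group law on the half-space, obtained from matrix multiplication by identifying
`(x₁, x₂, x₃)` with the matrix with rows
`(1, 0, 0, log x₃)`, `(0, x₃, 0, x₁)`, `(0, 0, x₃, x₂)`, `(0, 0, 0, 1)`.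
The identity is `(0, 0, 1)`; the de Sitter metric is left-invariant. -/
def groupMul (a y : EuclideanSpace ℝ (Fin 3)) : EuclideanSpace ℝ (Fin 3) :=
  !₂[a 2 * y 0 + a 0, a 2 * y 1 + a 1, a 2 * y 2]

/-- The inverse for `groupMul`. -/
def groupInv (a : EuclideanSpace ℝ (Fin 3)) : EuclideanSpace ℝ (Fin 3) :=
  !₂[-a 0 / a 2, -a 1 / a 2, 1 / a 2]

/-! ### Surfaces in the de Sitter space -/

variable {M : Type*} [TopologicalSpace M] [ChartedSpace (EuclideanSpace ℝ (Fin 2)) M]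

/-- The differential `df_p(v)` of a map from the surface to `ℝ³`. -/
def differential (f : M → EuclideanSpace ℝ (Fin 3)) (p : M) (v : TangentSpace (𝓡 2) p) :
    EuclideanSpace ℝ (Fin 3) :=
  mfderiv (𝓡 2) (𝓡 3) f p v

/-- The first fundamental form: the metric that `x` induces on `M`. -/
def firstForm (x : M → EuclideanSpace ℝ (Fin 3)) (p : M) (v w : TangentSpace (𝓡 2) p) : ℝ :=
  metric (x p) (differential x p v) (differential x p w)

/-- `x` is a smooth immersion into the half-space model and the metric it induces on the surface
`M` is Lorentzian (on a two-dimensional tangent space: it takes negative and positive values). -/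
structure IsTimelikeImmersion (x : M → EuclideanSpace ℝ (Fin 3)) : Prop where
  smooth : ContMDiff (𝓡 2) (𝓡 3) ∞ x
  mem_upperHalfSpace : ∀ p, x p ∈ upperHalfSpace
  injective : ∀ p, Function.Injective (differential x p)
  lorentzian : ∀ p, (∃ v, firstForm x p v v < 0) ∧ ∃ w, 0 < firstForm x p w w

/-- `N` is a smooth space-like unit normal vector field along `x`; the vector
`N p ∈ T_{x(p)} ℝ³₊ = ℝ³` is given by its components in the frame `∂/∂x₁, ∂/∂x₂, ∂/∂x₃`. -/
structure IsUnitNormal (x N : M → EuclideanSpace ℝ (Fin 3)) : Prop where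
  smooth : ContMDiff (𝓡 2) (𝓡 3) ∞ N
  unit : ∀ p, metric (x p) (N p) (N p) = 1
  normal : ∀ p (v : TangentSpace (𝓡 2) p), metric (x p) (differential x p v) (N p) = 0

/-- The covariant derivative `∇_v W` of a vector field `W` along `x`, for the Levi-Civita
connection of the de Sitter metric: `(∇_v W)^k = dW^k(v) + Γ^k_{ij}(x) dx^i(v) W^j`. -/
def covDeriv (x W : M → EuclideanSpace ℝ (Fin 3)) (p : M) (v : TangentSpace (𝓡 2) p) :
    EuclideanSpace ℝ (Fin 3) :=
  WithLp.toLp 2 fun k => differential W p v k +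
    ∑ i, ∑ j, christoffel metricCoeff k i j (x p) * differential x p v i * W p j

/-- The second fundamental form `II(v, w) = -⟨∇_v N, dx(w)⟩`. -/
def secondForm (x N : M → EuclideanSpace ℝ (Fin 3)) (p : M) (v w : TangentSpace (𝓡 2) p) : ℝ :=
  -metric (x p) (covDeriv x N p v) (differential x p w)

/-- `p` is an umbilic: `II` is a multiple of `I` at `p`. -/
def IsUmbilic (x N : M → EuclideanSpace ℝ (Fin 3)) (p : M) : Prop :=
  ∃ c : ℝ, ∀ v w : TangentSpace (𝓡 2) p, secondForm x N p v w = c * firstForm x p v w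

/-- The normal Gauss map: `N` left-translated to the tangent space `L³` at the identity. Its
components are the `η₁, η₂, η₃` with `N = ∑ A, x₃ η_A ∂/∂x_A`. -/
def normalGaussMap (x N : M → EuclideanSpace ℝ (Fin 3)) (p : M) : EuclideanSpace ℝ (Fin 3) :=
  fderiv ℝ (groupMul (groupInv (x p))) (x p) (N p)

/-- The fourth fundamental form `IV = ⟨dÑ, dÑ⟩` of the normal Gauss map `Ñ`. -/
def fourthForm (x N : M → EuclideanSpace ℝ (Fin 3)) (p : M) (v w : TangentSpace (𝓡 2) p) : ℝ :=
  minkowski (differential (normalGaussMap x N) p v) (differential (normalGaussMap x N) p w)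

/-- The normal Gauss map is conformal: `IV = ρ II` for a smooth function `ρ` on the surface. -/
def IsConformalNormalGaussMap (x N : M → EuclideanSpace ℝ (Fin 3)) : Prop :=
  ∃ ρ : M → ℝ, ContMDiff (𝓡 2) 𝓘(ℝ, ℝ) ∞ ρ ∧
    ∀ p (v w : TangentSpace (𝓡 2) p), fourthForm x N p v w = ρ p * secondForm x N p v w

/-- The coefficients `g_{ij}` of the first fundamental form in the chart of `M` at `p`: those of
the metric induced by the local parametrization `x ∘ φ⁻¹`. -/
def firstFormCoeff (x : M → EuclideanSpace ℝ (Fin 3)) (p : M) (u : EuclideanSpace ℝ (Fin 2)) :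
    Matrix (Fin 2) (Fin 2) ℝ :=
  Matrix.of fun i j =>
    metric (x ((chartAt (EuclideanSpace ℝ (Fin 2)) p).symm u))
      (fderiv ℝ (x ∘ (chartAt (EuclideanSpace ℝ (Fin 2)) p).symm) u (EuclideanSpace.single i 1))
      (fderiv ℝ (x ∘ (chartAt (EuclideanSpace ℝ (Fin 2)) p).symm) u (EuclideanSpace.single j 1))

/-- The Gauss curvature at `p` of the metric that `x` induces on `M`. It does not depend on the
chart; it is computed in the preferred chart at `p`. -/
def gaussCurvature (x : M → EuclideanSpace ℝ (Fin 3)) (p : M) : ℝ :=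
  gaussCurvatureCoord (firstFormCoeff x p) (chartAt (EuclideanSpace ℝ (Fin 2)) p p)

end

end DeSitter

open scoped Manifold ContDiff

namespace DeSitter

/-! ### Linear algebra of the Minkowski product -/

/-! Left translation to the identity divides a vector at height x₃ by x₃. In a chart the fundamental
forms therefore become Minkowski expressions in e_i = ∂_i F / x₃ and n = N / x₃. Let g, h be the
matrices of I, II and s = η₃.

Differentiating ⟨n, e_j⟩ = 0 gives ⟨∂_i n, e_j⟩ = -(h - s g)_{ij} (`minkowski_covFrame_normal`), and
⟨n, n⟩ = 1 makes ∂_i n tangential. Hence IV = (h - s g) g⁻¹ (h - s g), and Cayley-Hamilton for g⁻¹h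
turns this into IV = (tr(g⁻¹h) - 2s) II + (s² - det h / det g) I (`fourthCoeff_eq`). Away from
umbilics I and II are linearly independent, so IV = ρ II holds at a point exactly when det h = s²
det g and ρ = tr(g⁻¹h) - 2s (`conformal_at_iff`).

The ambient curvature is 1 and the normal is space-like, so the Gauss equation reads K = 1 + det h /
det g (`gaussCurvatureCoord_inducedCoeff`), and the condition on determinants becomes K = 1 + s².
The forced value of ρ is smooth, so smoothness costs nothing (`contMDiff_of_conformal`). -/

lemma minkowski_comm (v w : EuclideanSpace ℝ (Fin 3)) : minkowski v w = minkowski w v := by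
  simp only [minkowski]; ring

lemma minkowski_smul_left (c : ℝ) (v w : EuclideanSpace ℝ (Fin 3)) :
    minkowski (c • v) w = c * minkowski v w := by
  simp only [minkowski, PiLp.smul_apply, smul_eq_mul]; ring

lemma minkowski_smul_right (c : ℝ) (v w : EuclideanSpace ℝ (Fin 3)) :
    minkowski v (c • w) = c * minkowski v w := by
  simp only [minkowski, PiLp.smul_apply, smul_eq_mul]; ring

/-- The Gram determinant of two triples of vectors of `L³`. -/
lemma minkowski_gram (a b c p q r : EuclideanSpace ℝ (Fin 3)) :
    minkowski a p * (minkowski b q * minkowski c r - minkowski b r * minkowski c q)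
      - minkowski a q * (minkowski b p * minkowski c r - minkowski b r * minkowski c p)
      + minkowski a r * (minkowski b p * minkowski c q - minkowski b q * minkowski c p)
    = -((a 0 * (b 1 * c 2 - b 2 * c 1) - a 1 * (b 0 * c 2 - b 2 * c 0)
          + a 2 * (b 0 * c 1 - b 1 * c 0))
        * (p 0 * (q 1 * r 2 - q 2 * r 1) - p 1 * (q 0 * r 2 - q 2 * r 0)
          + p 2 * (q 0 * r 1 - q 1 * r 0))) := by
  simp only [minkowski]; ring

/-- Expansion of the Minkowski product in the basis `e, f, n`, where `n` is a unit vector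
orthogonal to `e` and `f`. -/
lemma minkowski_expand (a b e f n : EuclideanSpace ℝ (Fin 3)) (hn : minkowski n n = 1)
    (he : minkowski n e = 0) (hf : minkowski n f = 0) :
    (minkowski e e * minkowski f f - minkowski e f ^ 2)
        * (minkowski a b - minkowski a n * minkowski b n)
      = minkowski f f * (minkowski a e * minkowski b e)
        - minkowski e f * (minkowski a e * minkowski b f + minkowski a f * minkowski b e)
        + minkowski e e * (minkowski a f * minkowski b f) := by
  have h0 := minkowski_gram e f n e f n
  have h1 := minkowski_gram a f n e f n
  have h2 := minkowski_gram a e n e f n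
  have h3 := minkowski_gram a e f e f n
  have hfe := minkowski_comm f e
  have hen : minkowski e n = 0 := by rw [minkowski_comm, he]
  have hfn : minkowski f n = 0 := by rw [minkowski_comm, hf]
  simp only [hn, he, hf, hen, hfn, hfe] at h0 h1 h2 h3
  -- Cramer's rule for `a` in terms of `e, f, n`, cleared of denominators; it holds even when the
  -- three vectors are dependent.
  have key : ∀ i : Fin 3,
      (e 0 * (f 1 * n 2 - f 2 * n 1) - e 1 * (f 0 * n 2 - f 2 * n 0)
          + e 2 * (f 0 * n 1 - f 1 * n 0)) * a i
      = (a 0 * (f 1 * n 2 - f 2 * n 1) - a 1 * (f 0 * n 2 - f 2 * n 0)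
          + a 2 * (f 0 * n 1 - f 1 * n 0)) * e i
        - (a 0 * (e 1 * n 2 - e 2 * n 1) - a 1 * (e 0 * n 2 - e 2 * n 0)
          + a 2 * (e 0 * n 1 - e 1 * n 0)) * f i
        + (a 0 * (e 1 * f 2 - e 2 * f 1) - a 1 * (e 0 * f 2 - e 2 * f 0)
          + a 2 * (e 0 * f 1 - e 1 * f 0)) * n i := by
    intro i; fin_cases i <;> simp <;> ring
  set d0 := e 0 * (f 1 * n 2 - f 2 * n 1) - e 1 * (f 0 * n 2 - f 2 * n 0)
          + e 2 * (f 0 * n 1 - f 1 * n 0)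
  set d1 := a 0 * (f 1 * n 2 - f 2 * n 1) - a 1 * (f 0 * n 2 - f 2 * n 0)
          + a 2 * (f 0 * n 1 - f 1 * n 0)
  set d2 := a 0 * (e 1 * n 2 - e 2 * n 1) - a 1 * (e 0 * n 2 - e 2 * n 0)
          + a 2 * (e 0 * n 1 - e 1 * n 0)
  set d3 := a 0 * (e 1 * f 2 - e 2 * f 1) - a 1 * (e 0 * f 2 - e 2 * f 0)
          + a 2 * (e 0 * f 1 - e 1 * f 0)
  have hab : d0 * minkowski a b
      = d1 * minkowski b e - d2 * minkowski b f + d3 * minkowski b n := by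
    simp only [minkowski]
    linear_combination b 0 * key 0 + b 1 * key 1 - b 2 * key 2
  -- The Gram identities say that `-d0 * d0`, `-d1 * d0`, `-d2 * d0`, `-d3 * d0` are polynomials in
  -- scalar products, so multiplying `hab` by `-d0` removes all determinants.
  linear_combination (-d0) * hab + minkowski a b * h0 - minkowski b e * h1
    + minkowski b f * h2 - minkowski b n * h3

/-! ### Partial derivatives -/

section Calculus

variable {V : Type*} [NormedAddCommGroup V] [NormedSpace ℝ V] {m : ℕ}

/-- The partial derivative `∂_i f` of a vector-valued function. -/
noncomputable def pderiv (i : Fin m) (f : EuclideanSpace ℝ (Fin m) → V)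
    (u : EuclideanSpace ℝ (Fin m)) : V :=
  fderiv ℝ f u (EuclideanSpace.single i 1)

lemma partialDeriv_eq_pderiv (i : Fin m) (f : EuclideanSpace ℝ (Fin m) → ℝ) :
    partialDeriv i f = pderiv i f := rfl

lemma pderiv_congr {f g : EuclideanSpace ℝ (Fin m) → V} {U : Set (EuclideanSpace ℝ (Fin m))}
    (hU : IsOpen U) (h : Set.EqOn f g U) (i : Fin m) : Set.EqOn (pderiv i f) (pderiv i g) U := by
  intro u hu
  simp only [pderiv]
  rw [(Filter.eventuallyEq_of_mem (hU.mem_nhds hu) h).fderiv_eq]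

lemma contDiffOn_pderiv {f : EuclideanSpace ℝ (Fin m) → V} {U : Set (EuclideanSpace ℝ (Fin m))}
    (hU : IsOpen U) (h : ContDiffOn ℝ ∞ f U) (i : Fin m) : ContDiffOn ℝ ∞ (pderiv i f) U :=
  (h.fderiv_of_isOpen hU (by simp)).clm_apply contDiffOn_const

lemma pderiv_comm {f : EuclideanSpace ℝ (Fin m) → V} {U : Set (EuclideanSpace ℝ (Fin m))}
    (hU : IsOpen U) (h : ContDiffOn ℝ ∞ f U) (i j : Fin m) {u : EuclideanSpace ℝ (Fin m)}
    (hu : u ∈ U) : pderiv i (pderiv j f) u = pderiv j (pderiv i f) u := by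
  have hf : ContDiffAt ℝ ∞ f u := h.contDiffAt (hU.mem_nhds hu)
  have hd : DifferentiableAt ℝ (fderiv ℝ f) u :=
    (hf.fderiv_right (m := 1) (by norm_cast)).differentiableAt (by simp)
  have hs : IsSymmSndFDerivAt ℝ f u := hf.isSymmSndFDerivAt (by
    simpa using (WithTop.coe_le_coe.2 le_top : ((2 : ℕ∞) : WithTop ℕ∞) ≤ ∞))
  have aux : ∀ i j : Fin m, pderiv i (pderiv j f) u
      = fderiv ℝ (fderiv ℝ f) u (EuclideanSpace.single i 1) (EuclideanSpace.single j 1) := by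
    intro i j
    unfold pderiv
    rw [fderiv_clm_apply hd (differentiableAt_const _)]
    simp
  rw [aux, aux, hs.eq]

lemma differentiableAt_of_contDiffOn {f : EuclideanSpace ℝ (Fin m) → V}
    {U : Set (EuclideanSpace ℝ (Fin m))} (hU : IsOpen U) (h : ContDiffOn ℝ ∞ f U)
    {u : EuclideanSpace ℝ (Fin m)} (hu : u ∈ U) : DifferentiableAt ℝ f u :=
  (h.contDiffAt (hU.mem_nhds hu)).differentiableAt (by simp)

lemma pderiv_add {f g : EuclideanSpace ℝ (Fin m) → V} {u : EuclideanSpace ℝ (Fin m)}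
    (hf : DifferentiableAt ℝ f u) (hg : DifferentiableAt ℝ g u) (i : Fin m) :
    pderiv i (fun z => f z + g z) u = pderiv i f u + pderiv i g u := by
  simp [pderiv, fderiv_fun_add hf hg]

lemma pderiv_sub {f g : EuclideanSpace ℝ (Fin m) → V} {u : EuclideanSpace ℝ (Fin m)}
    (hf : DifferentiableAt ℝ f u) (hg : DifferentiableAt ℝ g u) (i : Fin m) :
    pderiv i (fun z => f z - g z) u = pderiv i f u - pderiv i g u := by
  simp [pderiv, fderiv_fun_sub hf hg]

lemma pderiv_smul {c : EuclideanSpace ℝ (Fin m) → ℝ} {f : EuclideanSpace ℝ (Fin m) → V}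
    {u : EuclideanSpace ℝ (Fin m)}
    (hc : DifferentiableAt ℝ c u) (hf : DifferentiableAt ℝ f u) (i : Fin m) :
    pderiv i (fun z => c z • f z) u = c u • pderiv i f u + pderiv i c u • f u := by
  simp [pderiv, fderiv_fun_smul hc hf]

lemma pderiv_mul {f g : EuclideanSpace ℝ (Fin m) → ℝ} {u : EuclideanSpace ℝ (Fin m)}
    (hf : DifferentiableAt ℝ f u) (hg : DifferentiableAt ℝ g u) (i : Fin m) :
    pderiv i (fun z => f z * g z) u = f u * pderiv i g u + pderiv i f u * g u :=
  pderiv_smul hf hg i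

lemma pderiv_inv {f : EuclideanSpace ℝ (Fin m) → ℝ} {u : EuclideanSpace ℝ (Fin m)}
    (hf : DifferentiableAt ℝ f u) (h0 : f u ≠ 0) (i : Fin m) :
    pderiv i (fun z => (f z)⁻¹) u = -((f u)⁻¹ ^ 2 * pderiv i f u) := by
  have h := ((hasDerivAt_inv h0).comp_hasFDerivAt u hf.hasFDerivAt).fderiv
  simp only [pderiv]
  erw [h]
  simp

lemma pderiv_const (c : V) (u : EuclideanSpace ℝ (Fin m)) (i : Fin m) :
    pderiv i (fun _ => c) u = 0 := by
  simp [pderiv]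

lemma pderiv_apply {k : ℕ} {f : EuclideanSpace ℝ (Fin m) → EuclideanSpace ℝ (Fin k)}
    {u : EuclideanSpace ℝ (Fin m)} (hf : DifferentiableAt ℝ f u) (i : Fin m) (a : Fin k) :
    pderiv i (fun z => f z a) u = pderiv i f u a := by
  have := ((EuclideanSpace.proj a : EuclideanSpace ℝ (Fin k) →L[ℝ] ℝ).hasFDerivAt.comp u
    hf.hasFDerivAt).fderiv
  simp only [pderiv]
  erw [this]
  rfl

lemma differentiableAt_minkowski {f g : EuclideanSpace ℝ (Fin m) → EuclideanSpace ℝ (Fin 3)}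
    {u : EuclideanSpace ℝ (Fin m)}
    (hf : DifferentiableAt ℝ f u) (hg : DifferentiableAt ℝ g u) :
    DifferentiableAt ℝ (fun z => minkowski (f z) (g z)) u := by
  have hf' := differentiableAt_euclidean.1 hf
  have hg' := differentiableAt_euclidean.1 hg
  simp only [minkowski]
  exact (((hf' 0).mul (hg' 0)).add ((hf' 1).mul (hg' 1))).sub ((hf' 2).mul (hg' 2))

lemma contDiffOn_minkowski {f g : EuclideanSpace ℝ (Fin m) → EuclideanSpace ℝ (Fin 3)}
    {U : Set (EuclideanSpace ℝ (Fin m))} (hf : ContDiffOn ℝ ∞ f U) (hg : ContDiffOn ℝ ∞ g U) :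
    ContDiffOn ℝ ∞ (fun z => minkowski (f z) (g z)) U := by
  have hf' := contDiffOn_euclidean.1 hf
  have hg' := contDiffOn_euclidean.1 hg
  simp only [minkowski]
  exact (((hf' 0).mul (hg' 0)).add ((hf' 1).mul (hg' 1))).sub ((hf' 2).mul (hg' 2))

lemma pderiv_minkowski {f g : EuclideanSpace ℝ (Fin m) → EuclideanSpace ℝ (Fin 3)}
    {u : EuclideanSpace ℝ (Fin m)}
    (hf : DifferentiableAt ℝ f u) (hg : DifferentiableAt ℝ g u) (i : Fin m) :
    pderiv i (fun z => minkowski (f z) (g z)) u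
      = minkowski (pderiv i f u) (g u) + minkowski (f u) (pderiv i g u) := by
  have hf' := differentiableAt_euclidean.1 hf
  have hg' := differentiableAt_euclidean.1 hg
  simp only [minkowski]
  rw [pderiv_sub (((hf' 0).fun_mul (hg' 0)).fun_add ((hf' 1).fun_mul (hg' 1)))
      ((hf' 2).fun_mul (hg' 2)),
    pderiv_add ((hf' 0).fun_mul (hg' 0)) ((hf' 1).fun_mul (hg' 1)), pderiv_mul (hf' 0) (hg' 0),
    pderiv_mul (hf' 1) (hg' 1), pderiv_mul (hf' 2) (hg' 2)]
  simp only [pderiv_apply hf, pderiv_apply hg]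
  ring

end Calculus

/-! ### Curvature of a two-dimensional metric through Christoffel symbols of the first kind -/

/-- Christoffel symbols `Γ_{l,ij}` of the first kind. -/
noncomputable def christoffelFirst {n : ℕ}
    (g : EuclideanSpace ℝ (Fin n) → Matrix (Fin n) (Fin n) ℝ)
    (l i j : Fin n) (u : EuclideanSpace ℝ (Fin n)) : ℝ :=
  (1 / 2) * (pderiv i (fun z => g z j l) u + pderiv j (fun z => g z i l) u
      - pderiv l (fun z => g z i j) u)

lemma christoffel_eq_sum {n : ℕ} (g : EuclideanSpace ℝ (Fin n) → Matrix (Fin n) (Fin n) ℝ)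
    (k i j : Fin n) (u : EuclideanSpace ℝ (Fin n)) :
    christoffel g k i j u = ∑ l, (g u)⁻¹ k l * christoffelFirst g l i j u := by
  simp only [christoffel, christoffelFirst, partialDeriv_eq_pderiv, Finset.mul_sum]
  exact Finset.sum_congr rfl fun l _ => by ring

section Surface

variable {g : EuclideanSpace ℝ (Fin 2) → Matrix (Fin 2) (Fin 2) ℝ}
  {U : Set (EuclideanSpace ℝ (Fin 2))}

lemma sum_metric_mul_christoffel (l i j : Fin 2) (u : EuclideanSpace ℝ (Fin 2))
    (hd : (g u).det ≠ 0) :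
    ∑ k, g u l k * christoffel g k i j u = christoffelFirst g l i j u := by
  have hone : (g u) * (g u)⁻¹ = 1 := Matrix.mul_nonsing_inv _ (Ne.isUnit hd)
  have h : ∀ a, ∑ k, g u l k * (g u)⁻¹ k a = (1 : Matrix (Fin 2) (Fin 2) ℝ) l a := by
    intro a; rw [← hone, Matrix.mul_apply]
  simp only [christoffel_eq_sum, Finset.mul_sum]
  rw [Finset.sum_comm]
  simp only [← mul_assoc, ← Finset.sum_mul, h]
  simp [Matrix.one_apply]

lemma contDiffOn_christoffelFirst (hU : IsOpen U)
    (hg : ∀ i j, ContDiffOn ℝ ∞ (fun z => g z i j) U) (l i j : Fin 2) :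
    ContDiffOn ℝ ∞ (christoffelFirst g l i j) U :=
  contDiffOn_const.mul (((contDiffOn_pderiv hU (hg j l) i).add
    (contDiffOn_pderiv hU (hg i l) j)).sub (contDiffOn_pderiv hU (hg i j) l))

lemma contDiffOn_inv_apply (hg : ∀ i j, ContDiffOn ℝ ∞ (fun z => g z i j) U)
    (hd : ∀ u ∈ U, (g u).det ≠ 0) (k l : Fin 2) :
    ContDiffOn ℝ ∞ (fun z => (g z)⁻¹ k l) U := by
  have hdet : ContDiffOn ℝ ∞ (fun z => (g z).det) U := by
    simp only [Matrix.det_fin_two]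
    exact ((hg 0 0).mul (hg 1 1)).sub ((hg 0 1).mul (hg 1 0))
  simp only [Matrix.inv_def, Ring.inverse_eq_inv', Matrix.smul_apply, smul_eq_mul]
  refine (hdet.inv hd).mul ?_
  simp only [Matrix.adjugate_fin_two]
  fin_cases k <;> fin_cases l <;> simp
  exacts [hg 1 1, (hg 0 1).neg, (hg 1 0).neg, hg 0 0]

lemma contDiffOn_christoffel (hU : IsOpen U)
    (hg : ∀ i j, ContDiffOn ℝ ∞ (fun z => g z i j) U)
    (hd : ∀ u ∈ U, (g u).det ≠ 0) (k i j : Fin 2) :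
    ContDiffOn ℝ ∞ (christoffel g k i j) U := by
  have h : christoffel g k i j = fun u => ∑ l, (g u)⁻¹ k l * christoffelFirst g l i j u :=
    funext fun u => christoffel_eq_sum g k i j u
  rw [h]
  exact ContDiffOn.sum fun l _ =>
    (contDiffOn_inv_apply hg hd k l).mul (contDiffOn_christoffelFirst hU hg l i j)

/-- Product rule applied to g_{la} Γ^a_{ij} = Γ_{l,ij}. It trades derivatives of Γ^a_{ij} for those
of Γ_{l,ij}, so the inverse metric is never differentiated explicitly. -/
lemma sum_metric_mul_pderiv_christoffel (hU : IsOpen U)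
    (hg : ∀ i j, ContDiffOn ℝ ∞ (fun z => g z i j) U)
    (hd : ∀ u ∈ U, (g u).det ≠ 0) (l i j k : Fin 2) {u : EuclideanSpace ℝ (Fin 2)} (hu : u ∈ U) :
    ∑ a, g u l a * pderiv k (christoffel g a i j) u
      = pderiv k (christoffelFirst g l i j) u
        - ∑ a, pderiv k (fun z => g z l a) u * christoffel g a i j u := by
  have h := pderiv_congr hU
    (fun z hz => sum_metric_mul_christoffel (g := g) l i j z (hd z hz)) k hu
  have dg := fun a => differentiableAt_of_contDiffOn hU (hg l a) hu
  have dc := fun a => differentiableAt_of_contDiffOn hU (contDiffOn_christoffel hU hg hd a i j) hu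
  simp only [Fin.sum_univ_two] at h ⊢
  rw [pderiv_add ((dg 0).fun_mul (dc 0)) ((dg 1).fun_mul (dc 1)), pderiv_mul (dg 0) (dc 0),
    pderiv_mul (dg 1) (dc 1)] at h
  linarith

/-- Lowering the index leaves terms ∂_k g_{la} Γ^a_{ij}. Metric compatibility, ∂_k g_{la} = Γ_{l,ka}
+ Γ_{a,kl}, splits each in two: one half cancels the quadratic terms of the curvature, the other is
what remains. -/
lemma sum_metric_mul_riemann (hU : IsOpen U)
    (hg : ∀ i j, ContDiffOn ℝ ∞ (fun z => g z i j) U) (hs : ∀ u i j, g u i j = g u j i)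
    (hd : ∀ u ∈ U, (g u).det ≠ 0) {u : EuclideanSpace ℝ (Fin 2)} (hu : u ∈ U) :
    ∑ l, g u 0 l * riemann g l 1 0 1 u
      = pderiv 0 (christoffelFirst g 0 1 1) u - pderiv 1 (christoffelFirst g 0 0 1) u
        - ∑ l, christoffelFirst g l 0 0 u * christoffel g l 1 1 u
        + ∑ l, christoffelFirst g l 0 1 u * christoffel g l 0 1 u := by
  have h0 := sum_metric_mul_pderiv_christoffel hU hg hd 0 1 1 0 hu
  have h1 := sum_metric_mul_pderiv_christoffel hU hg hd 0 0 1 1 hu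
  have c00 := sum_metric_mul_christoffel (g := g) 0 0 0 u (hd u hu)
  have c01 := sum_metric_mul_christoffel (g := g) 0 0 1 u (hd u hu)
  have c10 := sum_metric_mul_christoffel (g := g) 0 1 0 u (hd u hu)
  have c11 := sum_metric_mul_christoffel (g := g) 0 1 1 u (hd u hu)
  have hs' : (fun z => g z 1 0) = fun z => g z 0 1 := funext fun z => hs z 1 0
  simp only [riemann, partialDeriv_eq_pderiv, Fin.sum_univ_two] at *
  simp only [christoffelFirst, hs'] at *
  linear_combination h0 - h1 + christoffel g 0 1 1 u * c00 + christoffel g 1 1 1 u * c01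
    - christoffel g 0 0 1 u * c10 - christoffel g 1 0 1 u * c11

end Surface

/-! ### Local theory of surfaces: left-translated derivatives -/

section Local

variable {F n : EuclideanSpace ℝ (Fin 2) → EuclideanSpace ℝ (Fin 3)}
  {U : Set (EuclideanSpace ℝ (Fin 2))}

/-- A vector field along `F`, left-translated to the identity. -/
noncomputable def leftTranslate (F V : EuclideanSpace ℝ (Fin 2) → EuclideanSpace ℝ (Fin 3))
    (u : EuclideanSpace ℝ (Fin 2)) : EuclideanSpace ℝ (Fin 3) :=
  (F u 2)⁻¹ • V u

/-- The left-translated coordinate vector field `∂_i F`. -/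
noncomputable def frame (F : EuclideanSpace ℝ (Fin 2) → EuclideanSpace ℝ (Fin 3)) (i : Fin 2) :
    EuclideanSpace ℝ (Fin 2) → EuclideanSpace ℝ (Fin 3) :=
  leftTranslate F (pderiv i F)

/-- The left-translated second derivative `∂_i ∂_j F`. -/
noncomputable def frame₂ (F : EuclideanSpace ℝ (Fin 2) → EuclideanSpace ℝ (Fin 3))
    (i j : Fin 2) : EuclideanSpace ℝ (Fin 2) → EuclideanSpace ℝ (Fin 3) :=
  leftTranslate F (pderiv i (pderiv j F))

/-- The coefficients of the metric induced by `F`. -/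
noncomputable def inducedCoeff (F : EuclideanSpace ℝ (Fin 2) → EuclideanSpace ℝ (Fin 3))
    (u : EuclideanSpace ℝ (Fin 2)) : Matrix (Fin 2) (Fin 2) ℝ :=
  Matrix.of fun i j => minkowski (frame F i u) (frame F j u)

/-- The left-translated ambient covariant derivative `∇_i ∂_j F`. -/
noncomputable def covFrame (F : EuclideanSpace ℝ (Fin 2) → EuclideanSpace ℝ (Fin 3))
    (i j : Fin 2) (u : EuclideanSpace ℝ (Fin 2)) : EuclideanSpace ℝ (Fin 3) :=
  frame₂ F i j u - (frame F i u 2) • frame F j u - (frame F j u 2) • frame F i u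
    - (minkowski (frame F i u) (frame F j u)) • EuclideanSpace.single 2 1

lemma inducedCoeff_apply (i j : Fin 2) (u : EuclideanSpace ℝ (Fin 2)) :
    inducedCoeff F u i j = minkowski (frame F i u) (frame F j u) := rfl

lemma inducedCoeff_comm (F : EuclideanSpace ℝ (Fin 2) → EuclideanSpace ℝ (Fin 3))
    (u : EuclideanSpace ℝ (Fin 2)) (i j : Fin 2) : inducedCoeff F u i j = inducedCoeff F u j i :=
  minkowski_comm _ _

lemma det_inducedCoeff (F : EuclideanSpace ℝ (Fin 2) → EuclideanSpace ℝ (Fin 3))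
    (u : EuclideanSpace ℝ (Fin 2)) : (inducedCoeff F u).det
      = inducedCoeff F u 0 0 * inducedCoeff F u 1 1 - inducedCoeff F u 0 1 ^ 2 := by
  rw [Matrix.det_fin_two, inducedCoeff_comm F u 1 0]; ring

lemma contDiffOn_leftTranslate {V : EuclideanSpace ℝ (Fin 2) → EuclideanSpace ℝ (Fin 3)}
    (hF : ContDiffOn ℝ ∞ F U) (hpos : ∀ u ∈ U, 0 < F u 2) (hV : ContDiffOn ℝ ∞ V U) :
    ContDiffOn ℝ ∞ (leftTranslate F V) U :=
  ((contDiffOn_euclidean.1 hF 2).inv fun u hu => (hpos u hu).ne').smul hV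

/-- The derivative of 1/x₃ is -(∂_k x₃ / x₃)(1/x₃), and ∂_k x₃ / x₃ is the last component of e_k.
The left-translated calculus is thus closed: bare powers of x₃ never appear. -/
lemma pderiv_leftTranslate {V : EuclideanSpace ℝ (Fin 2) → EuclideanSpace ℝ (Fin 3)}
    (hU : IsOpen U) (hF : ContDiffOn ℝ ∞ F U) (hpos : ∀ u ∈ U, 0 < F u 2)
    (hV : ContDiffOn ℝ ∞ V U) (k : Fin 2) {u : EuclideanSpace ℝ (Fin 2)} (hu : u ∈ U) :
    pderiv k (leftTranslate F V) u
      = leftTranslate F (pderiv k V) u - (frame F k u 2) • leftTranslate F V u := by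
  have h2 := differentiableAt_of_contDiffOn hU (contDiffOn_euclidean.1 hF 2) hu
  have h := pderiv_smul (h2.fun_inv (hpos u hu).ne') (differentiableAt_of_contDiffOn hU hV hu) k
  rw [pderiv_inv h2 (hpos u hu).ne',
    pderiv_apply (differentiableAt_of_contDiffOn hU hF hu)] at h
  refine h.trans ?_
  simp only [leftTranslate, frame, PiLp.smul_apply, smul_eq_mul, smul_smul, neg_smul]
  rw [← sub_eq_add_neg]
  congr 2
  ring

lemma contDiffOn_frame (hU : IsOpen U) (hF : ContDiffOn ℝ ∞ F U) (hpos : ∀ u ∈ U, 0 < F u 2)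
    (i : Fin 2) : ContDiffOn ℝ ∞ (frame F i) U :=
  contDiffOn_leftTranslate hF hpos (contDiffOn_pderiv hU hF i)

lemma contDiffOn_frame₂ (hU : IsOpen U) (hF : ContDiffOn ℝ ∞ F U) (hpos : ∀ u ∈ U, 0 < F u 2)
    (i j : Fin 2) : ContDiffOn ℝ ∞ (frame₂ F i j) U :=
  contDiffOn_leftTranslate hF hpos (contDiffOn_pderiv hU (contDiffOn_pderiv hU hF j) i)

lemma contDiffOn_inducedCoeff (hU : IsOpen U) (hF : ContDiffOn ℝ ∞ F U)
    (hpos : ∀ u ∈ U, 0 < F u 2) (i j : Fin 2) :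
    ContDiffOn ℝ ∞ (fun z => inducedCoeff F z i j) U :=
  contDiffOn_minkowski (contDiffOn_frame hU hF hpos i) (contDiffOn_frame hU hF hpos j)

lemma frame₂_comm (hU : IsOpen U) (hF : ContDiffOn ℝ ∞ F U) (i j : Fin 2)
    {u : EuclideanSpace ℝ (Fin 2)} (hu : u ∈ U) : frame₂ F i j u = frame₂ F j i u := by
  simp only [frame₂, leftTranslate, pderiv_comm hU hF i j hu]

lemma pderiv_frame (hU : IsOpen U) (hF : ContDiffOn ℝ ∞ F U) (hpos : ∀ u ∈ U, 0 < F u 2)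
    (i k : Fin 2) {u : EuclideanSpace ℝ (Fin 2)} (hu : u ∈ U) :
    pderiv k (frame F i) u = frame₂ F k i u - (frame F k u 2) • frame F i u :=
  pderiv_leftTranslate hU hF hpos (contDiffOn_pderiv hU hF i) k hu

lemma pderiv_frame₂ (hU : IsOpen U) (hF : ContDiffOn ℝ ∞ F U) (hpos : ∀ u ∈ U, 0 < F u 2)
    (i j k : Fin 2) {u : EuclideanSpace ℝ (Fin 2)} (hu : u ∈ U) :
    pderiv k (frame₂ F i j) u = leftTranslate F (pderiv k (pderiv i (pderiv j F))) u
      - (frame F k u 2) • frame₂ F i j u :=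
  pderiv_leftTranslate hU hF hpos (contDiffOn_pderiv hU (contDiffOn_pderiv hU hF j) i) k hu

lemma pderiv_inducedCoeff (hU : IsOpen U) (hF : ContDiffOn ℝ ∞ F U) (hpos : ∀ u ∈ U, 0 < F u 2)
    (i j k : Fin 2) {u : EuclideanSpace ℝ (Fin 2)} (hu : u ∈ U) :
    pderiv k (fun z => inducedCoeff F z i j) u
      = minkowski (frame₂ F k i u) (frame F j u) + minkowski (frame F i u) (frame₂ F k j u)
        - 2 * frame F k u 2 * minkowski (frame F i u) (frame F j u) := by
  simp only [inducedCoeff_apply]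
  rw [pderiv_minkowski
    (differentiableAt_of_contDiffOn hU (contDiffOn_frame hU hF hpos i) hu)
    (differentiableAt_of_contDiffOn hU (contDiffOn_frame hU hF hpos j) hu),
    pderiv_frame hU hF hpos i k hu, pderiv_frame hU hF hpos j k hu]
  simp only [minkowski, PiLp.sub_apply, PiLp.smul_apply, smul_eq_mul]
  ring

lemma christoffelFirst_inducedCoeff (hU : IsOpen U) (hF : ContDiffOn ℝ ∞ F U)
    (hpos : ∀ u ∈ U, 0 < F u 2) (l i j : Fin 2) {u : EuclideanSpace ℝ (Fin 2)} (hu : u ∈ U) :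
    christoffelFirst (inducedCoeff F) l i j u
      = minkowski (frame₂ F i j u) (frame F l u)
        - frame F i u 2 * minkowski (frame F j u) (frame F l u)
        - frame F j u 2 * minkowski (frame F i u) (frame F l u)
        + frame F l u 2 * minkowski (frame F i u) (frame F j u) := by
  simp only [christoffelFirst, pderiv_inducedCoeff hU hF hpos _ _ _ hu]
  rw [frame₂_comm hU hF j i hu, frame₂_comm hU hF l i hu, frame₂_comm hU hF l j hu,
    minkowski_comm (frame F i u) (frame₂ F j l u), minkowski_comm (frame F j u) (frame₂ F i l u)]
  ring

/-- The induced connection is the tangential part of the ambient one. The term in e₃ contributes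
with a plus sign because e₃ is time-like. -/
lemma christoffelFirst_eq_covFrame (hU : IsOpen U) (hF : ContDiffOn ℝ ∞ F U)
    (hpos : ∀ u ∈ U, 0 < F u 2) (l i j : Fin 2) {u : EuclideanSpace ℝ (Fin 2)} (hu : u ∈ U) :
    christoffelFirst (inducedCoeff F) l i j u
      = minkowski (covFrame F i j u) (frame F l u) := by
  rw [christoffelFirst_inducedCoeff hU hF hpos l i j hu]
  simp [minkowski, covFrame]
  ring

lemma pderiv_christoffelFirst (hU : IsOpen U) (hF : ContDiffOn ℝ ∞ F U)
    (hpos : ∀ u ∈ U, 0 < F u 2) (l i j k : Fin 2) {u : EuclideanSpace ℝ (Fin 2)} (hu : u ∈ U) :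
    pderiv k (christoffelFirst (inducedCoeff F) l i j) u
      = minkowski (pderiv k (frame₂ F i j) u) (frame F l u)
        + minkowski (frame₂ F i j u) (pderiv k (frame F l) u)
        - (frame F i u 2 * pderiv k (fun z => inducedCoeff F z j l) u
          + pderiv k (frame F i) u 2 * minkowski (frame F j u) (frame F l u))
        - (frame F j u 2 * pderiv k (fun z => inducedCoeff F z i l) u
          + pderiv k (frame F j) u 2 * minkowski (frame F i u) (frame F l u))
        + (frame F l u 2 * pderiv k (fun z => inducedCoeff F z i j) u
          + pderiv k (frame F l) u 2 * minkowski (frame F i u) (frame F j u)) := by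
  rw [pderiv_congr hU
    (fun z hz => christoffelFirst_inducedCoeff (F := F) hU hF hpos l i j hz) k hu]
  have dE := fun i => differentiableAt_of_contDiffOn hU (contDiffOn_frame hU hF hpos i) hu
  have dA := differentiableAt_of_contDiffOn hU (contDiffOn_frame₂ hU hF hpos i j) hu
  have dE2 := fun i => differentiableAt_euclidean.1 (dE i) 2
  have dg := fun i j => differentiableAt_minkowski (dE i) (dE j)
  have t0 := differentiableAt_minkowski dA (dE l)
  have t1 := (dE2 i).fun_mul (dg j l)
  have t2 := (dE2 j).fun_mul (dg i l)
  have t3 := (dE2 l).fun_mul (dg i j)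
  rw [pderiv_add ((t0.fun_sub t1).fun_sub t2) t3, pderiv_sub (t0.fun_sub t1) t2,
    pderiv_sub t0 t1, pderiv_mul (dE2 i) (dg j l), pderiv_mul (dE2 j) (dg i l),
    pderiv_mul (dE2 l) (dg i j), pderiv_minkowski dA (dE l)]
  simp only [pderiv_apply (dE _), inducedCoeff_apply]

/-- The tangential part of the Gauss formula. -/
lemma sum_christoffelFirst_mul_christoffel (hU : IsOpen U) (hF : ContDiffOn ℝ ∞ F U)
    (hpos : ∀ u ∈ U, 0 < F u 2) {u : EuclideanSpace ℝ (Fin 2)} (hu : u ∈ U)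
    {w : EuclideanSpace ℝ (Fin 3)} (hw : minkowski w w = 1)
    (hwE : ∀ i, minkowski w (frame F i u) = 0) (hd : (inducedCoeff F u).det ≠ 0)
    (i j k m : Fin 2) :
    ∑ l, christoffelFirst (inducedCoeff F) l i j u * christoffel (inducedCoeff F) l k m u
      = minkowski (covFrame F i j u) (covFrame F k m u)
        - minkowski (covFrame F i j u) w * minkowski (covFrame F k m u) w := by
  -- Divided by the determinant of the induced metric, the right side of this expansion is the
  -- contraction with the adjugate formula for the inverse metric.
  have h := minkowski_expand (covFrame F i j u) (covFrame F k m u) (frame F 0 u) (frame F 1 u)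
    w hw (hwE 0) (hwE 1)
  simp only [christoffel_eq_sum, Matrix.inv_def, Ring.inverse_eq_inv', Matrix.adjugate_fin_two,
    Fin.sum_univ_two, christoffelFirst_eq_covFrame hU hF hpos _ _ _ hu]
  have hdet := det_inducedCoeff F u
  simp only [inducedCoeff_apply] at hdet
  rw [← hdet] at h
  have h' := congrArg (fun t => (inducedCoeff F u).det⁻¹ * t) h
  simp only [← mul_assoc, inv_mul_cancel₀ hd, one_mul] at h'
  rw [h']
  simp [inducedCoeff_apply, minkowski_comm (frame F 1 u) (frame F 0 u)]
  ring

/-- The Gauss equation of a surface in the de Sitter space. -/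
lemma gaussCurvatureCoord_inducedCoeff (hU : IsOpen U) (hF : ContDiffOn ℝ ∞ F U)
    (hpos : ∀ u ∈ U, 0 < F u 2) (hd : ∀ u ∈ U, (inducedCoeff F u).det ≠ 0)
    {u : EuclideanSpace ℝ (Fin 2)} (hu : u ∈ U)
    {w : EuclideanSpace ℝ (Fin 3)} (hw : minkowski w w = 1)
    (hwE : ∀ i, minkowski w (frame F i u) = 0) :
    gaussCurvatureCoord (inducedCoeff F) u = 1
      + (minkowski (covFrame F 0 0 u) w * minkowski (covFrame F 1 1 u) w
          - minkowski (covFrame F 0 1 u) w ^ 2) / (inducedCoeff F u).det := by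
  have hdet := det_inducedCoeff F u
  simp only [inducedCoeff_apply] at hdet
  have hd' := hd u hu
  -- Third derivatives of `F` enter only through ∂₀∂₁∂₁F and ∂₁∂₀∂₁F; their equality makes them
  -- cancel.
  have hB : leftTranslate F (pderiv 1 (pderiv 0 (pderiv 1 F))) u
      = leftTranslate F (pderiv 0 (pderiv 1 (pderiv 1 F))) u := by
    simp only [leftTranslate]
    rw [pderiv_comm hU (contDiffOn_pderiv hU hF 1) 1 0 hu]
  rw [gaussCurvatureCoord, sum_metric_mul_riemann hU (contDiffOn_inducedCoeff hU hF hpos)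
    (fun z i j => minkowski_comm _ _) hd hu,
    sum_christoffelFirst_mul_christoffel hU hF hpos hu hw hwE hd',
    sum_christoffelFirst_mul_christoffel hU hF hpos hu hw hwE hd']
  simp only [inducedCoeff_apply (F := F), ← hdet]
  rw [div_eq_iff hd', add_mul, div_mul_cancel₀ _ hd', hdet]
  simp only [pderiv_christoffelFirst hU hF hpos _ _ _ _ hu,
    pderiv_inducedCoeff hU hF hpos _ _ _ hu, pderiv_frame hU hF hpos _ _ hu,
    pderiv_frame₂ hU hF hpos _ _ _ hu, hB, frame₂_comm hU hF 1 0 hu]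
  -- The normal components agree on both sides and may stay opaque. What is left is a polynomial
  -- identity in the derivatives of `F`, expressing that the ambient curvature is 1.
  generalize minkowski (covFrame F 0 0 u) w = a, minkowski (covFrame F 1 1 u) w = b,
    minkowski (covFrame F 0 1 u) w = c
  simp [minkowski, covFrame]
  ring

/-- The second fundamental form through the derivative of the left-translated normal. -/
lemma minkowski_covFrame_normal (hU : IsOpen U) (hF : ContDiffOn ℝ ∞ F U)
    (hpos : ∀ u ∈ U, 0 < F u 2) (hn : ContDiffOn ℝ ∞ n U)
    (hnE : ∀ u ∈ U, ∀ i, minkowski (n u) (frame F i u) = 0) (i j : Fin 2)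
    {u : EuclideanSpace ℝ (Fin 2)} (hu : u ∈ U) :
    minkowski (covFrame F i j u) (n u)
      = -minkowski (pderiv i n u) (frame F j u)
        + n u 2 * minkowski (frame F i u) (frame F j u) := by
  have h : pderiv i (fun z => minkowski (n z) (frame F j z)) u = 0 := by
    rw [pderiv_congr hU (fun z hz => hnE z hz j) i hu, pderiv_const]
  rw [pderiv_minkowski (differentiableAt_of_contDiffOn hU hn hu)
    (differentiableAt_of_contDiffOn hU (contDiffOn_frame hU hF hpos j) hu),
    pderiv_frame hU hF hpos j i hu] at h
  have hi := hnE u hu i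
  have hj := hnE u hu j
  simp [minkowski, covFrame] at h hi hj ⊢
  -- The summand with the third component of `n` comes from ⟨e₃, n⟩ = -n₃; of the two other
  -- corrections in `covFrame`, one matches the derivative of the frame and one vanishes by `hi`.
  linear_combination h - frame F j u 2 * hi

end Local

/-! ### The Levi-Civita connection of the half-space model -/

lemma metricCoeff_eq (y : EuclideanSpace ℝ (Fin 3)) :
    metricCoeff y = Matrix.diagonal fun i => ((y 2)⁻¹) ^ 2 * (![1, 1, -1] : Fin 3 → ℝ) i := by
  ext i j
  fin_cases i <;> fin_cases j <;>
    simp [metricCoeff, metric, minkowski, Matrix.diagonal, neg_div]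

lemma metricCoeff_inv {y : EuclideanSpace ℝ (Fin 3)} (hy : y 2 ≠ 0) :
    (metricCoeff y)⁻¹ = Matrix.diagonal fun i => (y 2) ^ 2 * (![1, 1, -1] : Fin 3 → ℝ) i := by
  apply Matrix.inv_eq_right_inv
  rw [metricCoeff_eq, Matrix.diagonal_mul_diagonal, ← Matrix.diagonal_one]
  congr 1
  funext i
  fin_cases i <;> simp <;> field_simp

lemma pderiv_metricCoeff {y : EuclideanSpace ℝ (Fin 3)} (hy : y 2 ≠ 0) (l i j : Fin 3) :
    pderiv l (fun z => metricCoeff z i j) y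
      = -2 * (y 2)⁻¹ ^ 3 * (if l = 2 then 1 else 0)
        * Matrix.diagonal (![1, 1, -1] : Fin 3 → ℝ) i j := by
  have h2 : DifferentiableAt ℝ (fun z : EuclideanSpace ℝ (Fin 3) => z 2) y :=
    differentiableAt_euclidean.1 differentiableAt_id 2
  have hp : pderiv l (fun z : EuclideanSpace ℝ (Fin 3) => z 2) y = if l = 2 then 1 else 0 := by
    rw [pderiv_apply (f := fun z => z) differentiableAt_id]
    simp [pderiv, eq_comm]
  have h : (fun z => metricCoeff z i j) = fun z : EuclideanSpace ℝ (Fin 3) =>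
      ((z 2)⁻¹ * (z 2)⁻¹) * Matrix.diagonal (![1, 1, -1] : Fin 3 → ℝ) i j := by
    funext z
    rw [metricCoeff_eq]
    by_cases hij : i = j
    · subst hij; simp only [Matrix.diagonal_apply_eq]; ring
    · simp [Matrix.diagonal_apply_ne _ hij]
  have hi := h2.fun_inv hy
  rw [h, pderiv_mul (hi.fun_mul hi) (differentiableAt_const _), pderiv_mul hi hi,
    pderiv_inv h2 hy, pderiv_const, hp]
  ring

/-- The metric is x₃⁻² times the flat one, so the connection is the flat one corrected by dφ(v)w +
dφ(w)v - ⟨v, w⟩ grad φ with φ = -log x₃. The flat Lorentz gradient of φ is e₃ / x₃. -/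
lemma sum_christoffel_metricCoeff {y : EuclideanSpace ℝ (Fin 3)} (hy : y 2 ≠ 0)
    (v w : EuclideanSpace ℝ (Fin 3)) (k : Fin 3) :
    ∑ i, ∑ j, christoffel metricCoeff k i j y * v i * w j
      = -(y 2)⁻¹ * (w 2 * v k + v 2 * w k
          + minkowski v w * (EuclideanSpace.single 2 1 : EuclideanSpace ℝ (Fin 3)) k) := by
  simp only [christoffel, partialDeriv_eq_pderiv, metricCoeff_inv hy, pderiv_metricCoeff hy,
    Fin.sum_univ_three, minkowski]
  fin_cases k <;> simp <;> field_simp <;> ring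

/-! ### Pointwise algebra of the fundamental forms -/

/-- The Cayley-Hamilton identity for a fundamental form `k` with
`k = (h - s g) g⁻¹ (h - s g)`. -/
lemma fourth_cayley_hamilton (g h k : Fin 2 → Fin 2 → ℝ) (s : ℝ) (hg : g 1 0 = g 0 1)
    (hh : h 1 0 = h 0 1)
    (hk : ∀ i j, (g 0 0 * g 1 1 - g 0 1 ^ 2) * k i j
      = g 1 1 * ((h i 0 - s * g i 0) * (h j 0 - s * g j 0))
        - g 0 1 * ((h i 0 - s * g i 0) * (h j 1 - s * g j 1)
          + (h i 1 - s * g i 1) * (h j 0 - s * g j 0))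
        + g 0 0 * ((h i 1 - s * g i 1) * (h j 1 - s * g j 1))) (i j : Fin 2) :
    (g 0 0 * g 1 1 - g 0 1 ^ 2) * k i j
      = (g 1 1 * h 0 0 - 2 * g 0 1 * h 0 1 + g 0 0 * h 1 1
          - 2 * s * (g 0 0 * g 1 1 - g 0 1 ^ 2)) * h i j
        + (s ^ 2 * (g 0 0 * g 1 1 - g 0 1 ^ 2) - (h 0 0 * h 1 1 - h 0 1 ^ 2)) * g i j := by
  rw [hk i j]
  fin_cases i <;> fin_cases j <;> simp [hg, hh] <;> ring

/-- Substituting k = r h into the Cayley-Hamilton identity gives a linear relation between h and g.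
If h had a nonzero coefficient, the point would be umbilic; so that coefficient is zero, and since g
≠ 0 the one of g is zero as well. -/
lemma det_second_eq_of_conformal (g h k : Fin 2 → Fin 2 → ℝ) (s r : ℝ)
    (hd : g 0 0 * g 1 1 - g 0 1 ^ 2 ≠ 0)
    (hk : ∀ i j, (g 0 0 * g 1 1 - g 0 1 ^ 2) * k i j
      = (g 1 1 * h 0 0 - 2 * g 0 1 * h 0 1 + g 0 0 * h 1 1
          - 2 * s * (g 0 0 * g 1 1 - g 0 1 ^ 2)) * h i j
        + (s ^ 2 * (g 0 0 * g 1 1 - g 0 1 ^ 2) - (h 0 0 * h 1 1 - h 0 1 ^ 2)) * g i j)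
    (humb : ¬ ∃ c : ℝ, ∀ i j, h i j = c * g i j) (hr : ∀ i j, k i j = r * h i j) :
    h 0 0 * h 1 1 - h 0 1 ^ 2 = s ^ 2 * (g 0 0 * g 1 1 - g 0 1 ^ 2) := by
  set D := g 0 0 * g 1 1 - g 0 1 ^ 2 with hD
  set a := g 1 1 * h 0 0 - 2 * g 0 1 * h 0 1 + g 0 0 * h 1 1 - 2 * s * D
  set b := s ^ 2 * D - (h 0 0 * h 1 1 - h 0 1 ^ 2) with hb
  have hab : ∀ i j, (a - D * r) * h i j = -b * g i j := fun i j => by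
    have := hk i j
    rw [hr i j] at this
    linarith
  by_cases ha : a - D * r = 0
  · have hb0 : b = 0 := by
      by_contra hbn
      have hg : ∀ i j, g i j = 0 := fun i j => by
        have := hab i j
        rw [ha, zero_mul] at this
        simpa [hbn] using this
      exact hd (by rw [hD, hg 0 0, hg 0 1]; ring)
    linarith
  · exact absurd ⟨-b / (a - D * r), fun i j => by
      rw [div_mul_eq_mul_div, eq_div_iff ha, ← hab i j, mul_comm]⟩ humb

/-! ### Fundamental forms in a chart -/

/-- Left translation by the inverse of `x p` is affine, with linear part the scaling by 1/x₃. -/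
lemma normalGaussMap_eq {M : Type*} (x N : M → EuclideanSpace ℝ (Fin 3)) (p : M) :
    normalGaussMap x N p = (x p 2)⁻¹ • N p := by
  have h : groupMul (groupInv (x p)) = fun y : EuclideanSpace ℝ (Fin 3) =>
      (x p 2)⁻¹ • y + !₂[-(x p 0) / x p 2, -(x p 1) / x p 2, 0] := by
    funext y
    ext i
    fin_cases i <;> simp [groupMul, groupInv]
  have hd := (((hasFDerivAt_id (𝕜 := ℝ) (x p)).const_smul (x p 2)⁻¹).add_const
    !₂[-(x p 0) / x p 2, -(x p 1) / x p 2, 0]).fderiv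
  rw [normalGaussMap, h]
  erw [hd]
  rfl

section Chart

variable {M : Type*} [TopologicalSpace M] [ChartedSpace (EuclideanSpace ℝ (Fin 2)) M]

/-- The local parametrization of a surface given by the chart at `p`. -/
noncomputable def localMap (f : M → EuclideanSpace ℝ (Fin 3)) (p : M) :
    EuclideanSpace ℝ (Fin 2) → EuclideanSpace ℝ (Fin 3) :=
  f ∘ (chartAt (EuclideanSpace ℝ (Fin 2)) p).symm

lemma differential_lincomb (f : M → EuclideanSpace ℝ (Fin 3)) (p : M)
    (v w : TangentSpace (𝓡 2) p) (a b : ℝ) :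
    differential f p (a • v + b • w) = a • differential f p v + b • differential f p w := by
  simp only [differential, map_add, map_smul]
  rfl

lemma covDeriv_eq {x : M → EuclideanSpace ℝ (Fin 3)} {p : M} (hp : x p 2 ≠ 0)
    (N : M → EuclideanSpace ℝ (Fin 3)) (v : TangentSpace (𝓡 2) p) :
    covDeriv x N p v = differential N p v + (-(x p 2)⁻¹) • ((N p 2) • differential x p v
      + (differential x p v 2) • N p
      + (minkowski (differential x p v) (N p)) • EuclideanSpace.single 2 1) := by
  ext k
  simp only [covDeriv, sum_christoffel_metricCoeff hp, PiLp.add_apply, PiLp.smul_apply,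
    smul_eq_mul]

lemma firstForm_lincomb (x : M → EuclideanSpace ℝ (Fin 3)) (p : M)
    (v w : TangentSpace (𝓡 2) p) (a b c d : ℝ) :
    firstForm x p (a • v + b • w) (c • v + d • w)
      = a * c * firstForm x p v v + a * d * firstForm x p v w
        + b * c * firstForm x p w v + b * d * firstForm x p w w := by
  simp only [firstForm, metric, differential_lincomb, minkowski, PiLp.add_apply, PiLp.smul_apply,
    smul_eq_mul]
  ring

lemma fourthForm_lincomb (x N : M → EuclideanSpace ℝ (Fin 3)) (p : M)
    (v w : TangentSpace (𝓡 2) p) (a b c d : ℝ) :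
    fourthForm x N p (a • v + b • w) (c • v + d • w)
      = a * c * fourthForm x N p v v + a * d * fourthForm x N p v w
        + b * c * fourthForm x N p w v + b * d * fourthForm x N p w w := by
  simp only [fourthForm, differential_lincomb, minkowski, PiLp.add_apply, PiLp.smul_apply,
    smul_eq_mul]
  ring

lemma secondForm_lincomb {x : M → EuclideanSpace ℝ (Fin 3)} {p : M} (hp : x p 2 ≠ 0)
    (N : M → EuclideanSpace ℝ (Fin 3)) (v w : TangentSpace (𝓡 2) p) (a b c d : ℝ) :
    secondForm x N p (a • v + b • w) (c • v + d • w)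
      = a * c * secondForm x N p v v + a * d * secondForm x N p v w
        + b * c * secondForm x N p w v + b * d * secondForm x N p w w := by
  simp only [secondForm, covDeriv_eq hp, metric, differential_lincomb, minkowski, PiLp.add_apply,
    PiLp.smul_apply, smul_eq_mul]
  ring

variable [IsManifold (𝓡 2) ∞ M]

/-- The coordinate vectors of the chart at `p` form a basis of the tangent spaces. -/
lemma exists_coordinate_vectors (p : M) {u : EuclideanSpace ℝ (Fin 2)}
    (hu : u ∈ (chartAt (EuclideanSpace ℝ (Fin 2)) p).target) :
    ∃ w : Fin 2 → TangentSpace (𝓡 2) ((chartAt (EuclideanSpace ℝ (Fin 2)) p).symm u),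
      (∀ v, ∃ a b : ℝ, v = a • w 0 + b • w 1) ∧
      ∀ f : M → EuclideanSpace ℝ (Fin 3), ContMDiff (𝓡 2) (𝓡 3) ∞ f → ∀ i,
        differential f _ (w i)
          = pderiv i (localMap f p) u := by
  have hφ := (mdifferentiable_chart (I := 𝓡 2) (M := M) p).symm
  have hat : MDifferentiableAt (𝓡 2) (𝓡 2)
    (chartAt (EuclideanSpace ℝ (Fin 2)) p).symm u := hφ.mdifferentiableAt hu
  -- The vectors are the images of the standard basis under the differential of the inverse chart,
  -- whose surjectivity gives the spanning property.
  refine ⟨fun i => mfderiv (𝓡 2) (𝓡 2) (chartAt (EuclideanSpace ℝ (Fin 2)) p).symm u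
    (EuclideanSpace.single i 1 : EuclideanSpace ℝ (Fin 2)), fun v => ?_, fun f hf i => ?_⟩
  · obtain ⟨z, rfl⟩ := hφ.mfderiv_surjective hu v
    have hz : ∀ z : EuclideanSpace ℝ (Fin 2), z = z 0 • EuclideanSpace.single 0 1
        + z 1 • EuclideanSpace.single 1 1 := by
      intro z
      ext i
      fin_cases i <;> simp
    let z' : EuclideanSpace ℝ (Fin 2) := z
    refine ⟨z' 0, z' 1, ?_⟩
    let T : EuclideanSpace ℝ (Fin 2) →L[ℝ] TangentSpace (𝓡 2)
        ((chartAt (EuclideanSpace ℝ (Fin 2)) p).symm u) :=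
      mfderiv (𝓡 2) (𝓡 2) (chartAt (EuclideanSpace ℝ (Fin 2)) p).symm u
    have h := congrArg T (hz z')
    rw [map_add, map_smul, map_smul] at h
    exact h
  · have hf' := (hf ((chartAt (EuclideanSpace ℝ (Fin 2)) p).symm u)).mdifferentiableAt (by simp)
    have h := mfderiv_comp_apply u hf' hat
      (EuclideanSpace.single i 1 : EuclideanSpace ℝ (Fin 2))
    rw [mfderiv_eq_fderiv] at h
    exact h.symm

lemma contDiffOn_localMap {f : M → EuclideanSpace ℝ (Fin 3)}
    (hf : ContMDiff (𝓡 2) (𝓡 3) ∞ f) (p : M) :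
    ContDiffOn ℝ ∞ (localMap f p) (chartAt (EuclideanSpace ℝ (Fin 2)) p).target :=
  contMDiffOn_iff_contDiffOn.1 (hf.comp_contMDiffOn contMDiffOn_chart_symm)

end Chart

/-! ### Conformality and the Gauss curvature -/

section Main

variable {M : Type*} [TopologicalSpace M] [ChartedSpace (EuclideanSpace ℝ (Fin 2)) M]
  {x N : M → EuclideanSpace ℝ (Fin 3)}

/-- The coefficients of the second fundamental form in the chart at `p`. -/
noncomputable def secondCoeff (x N : M → EuclideanSpace ℝ (Fin 3)) (p : M)
    (u : EuclideanSpace ℝ (Fin 2)) (i j : Fin 2) : ℝ :=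
  minkowski (covFrame (localMap x p) i j u) (leftTranslate (localMap x p) (localMap N p) u)

/-- The coefficients of the fourth fundamental form in the chart at `p`. -/
noncomputable def fourthCoeff (x N : M → EuclideanSpace ℝ (Fin 3)) (p : M)
    (u : EuclideanSpace ℝ (Fin 2)) (i j : Fin 2) : ℝ :=
  minkowski (pderiv i (leftTranslate (localMap x p) (localMap N p)) u)
    (pderiv j (leftTranslate (localMap x p) (localMap N p)) u)

lemma firstFormCoeff_eq (x : M → EuclideanSpace ℝ (Fin 3)) (p : M) :
    firstFormCoeff x p = inducedCoeff (localMap x p) := by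
  funext u
  ext i j
  simp only [firstFormCoeff, inducedCoeff, Matrix.of_apply, metric, frame, leftTranslate,
    minkowski_smul_left, minkowski_smul_right, pderiv, localMap, Function.comp_apply]
  rw [div_eq_mul_inv, ← inv_pow]
  ring

lemma localMap_pos (hx : IsTimelikeImmersion x) (p : M) :
    ∀ u ∈ (chartAt (EuclideanSpace ℝ (Fin 2)) p).target, 0 < localMap x p u 2 :=
  fun _ _ => hx.mem_upperHalfSpace _

lemma contMDiff_normalGaussMap (hx : IsTimelikeImmersion x) (hN : IsUnitNormal x N) :
    ContMDiff (𝓡 2) (𝓡 3) ∞ (normalGaussMap x N) := by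
  have h : normalGaussMap x N = fun p => (x p 2)⁻¹ • N p := funext (normalGaussMap_eq x N)
  rw [h]
  have h2 : ContMDiff (𝓡 2) 𝓘(ℝ, ℝ) ∞ fun p => x p 2 :=
    ((EuclideanSpace.proj 2 : EuclideanSpace ℝ (Fin 3) →L[ℝ] ℝ).contMDiff).comp hx.smooth
  exact (h2.inv₀ fun p => (hx.mem_upperHalfSpace p).ne').smul hN.smooth

lemma minkowski_localNormal_self (hN : IsUnitNormal x N) (p : M)
    (u : EuclideanSpace ℝ (Fin 2)) :
    minkowski (leftTranslate (localMap x p) (localMap N p) u)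
      (leftTranslate (localMap x p) (localMap N p) u) = 1 := by
  have h := hN.unit ((chartAt (EuclideanSpace ℝ (Fin 2)) p).symm u)
  simp only [leftTranslate, minkowski_smul_left, minkowski_smul_right, localMap,
    Function.comp_apply]
  rw [metric, div_eq_mul_inv, ← inv_pow] at h
  linarith

/-- The third component of the normal Gauss map in the chart at `p`. -/
noncomputable def gaussHeight (x N : M → EuclideanSpace ℝ (Fin 3)) (p : M)
    (u : EuclideanSpace ℝ (Fin 2)) : ℝ :=
  leftTranslate (localMap x p) (localMap N p) u 2

lemma gaussHeight_chartAt (p : M) :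
    gaussHeight x N p (chartAt (EuclideanSpace ℝ (Fin 2)) p p) = normalGaussMap x N p 2 := by
  simp [gaussHeight, leftTranslate, localMap, normalGaussMap_eq]

variable [IsManifold (𝓡 2) ∞ M]

lemma contDiffOn_localNormal (hx : IsTimelikeImmersion x) (hN : IsUnitNormal x N) (p : M) :
    ContDiffOn ℝ ∞ (leftTranslate (localMap x p) (localMap N p))
      (chartAt (EuclideanSpace ℝ (Fin 2)) p).target :=
  contDiffOn_leftTranslate (contDiffOn_localMap hx.smooth p) (localMap_pos hx p)
    (contDiffOn_localMap hN.smooth p)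

lemma minkowski_localNormal_frame (hx : IsTimelikeImmersion x) (hN : IsUnitNormal x N) (p : M)
    {u : EuclideanSpace ℝ (Fin 2)} (hu : u ∈ (chartAt (EuclideanSpace ℝ (Fin 2)) p).target)
    (i : Fin 2) :
    minkowski (leftTranslate (localMap x p) (localMap N p) u) (frame (localMap x p) i u) = 0 := by
  obtain ⟨w, -, hw⟩ := exists_coordinate_vectors (M := M) p hu
  have h := hN.normal _ (w i)
  rw [hw x hx.smooth, metric, div_eq_zero_iff] at h
  have h' : minkowski (pderiv i (localMap x p) u) (localMap N p u) = 0 :=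
    h.resolve_right (pow_ne_zero 2 (hx.mem_upperHalfSpace _).ne')
  simp only [frame, leftTranslate, minkowski_smul_left, minkowski_smul_right]
  rw [minkowski_comm, h', mul_zero, mul_zero]

/-- The fundamental forms on a basis of coordinate vectors. -/
lemma exists_basis_forms (hx : IsTimelikeImmersion x) (hN : IsUnitNormal x N) (p : M)
    {u : EuclideanSpace ℝ (Fin 2)} (hu : u ∈ (chartAt (EuclideanSpace ℝ (Fin 2)) p).target) :
    ∃ w : Fin 2 → TangentSpace (𝓡 2) ((chartAt (EuclideanSpace ℝ (Fin 2)) p).symm u),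
      (∀ v, ∃ a b : ℝ, v = a • w 0 + b • w 1) ∧ ∀ i j,
        firstForm x _ (w i) (w j) = inducedCoeff (localMap x p) u i j ∧
        secondForm x N _ (w i) (w j) = secondCoeff x N p u i j ∧
        fourthForm x N _ (w i) (w j) = fourthCoeff x N p u i j := by
  obtain ⟨w, hspan, hw⟩ := exists_coordinate_vectors (M := M) p hu
  have hU := (chartAt (EuclideanSpace ℝ (Fin 2)) p).open_target
  have hF := contDiffOn_localMap hx.smooth p
  have hNf := contDiffOn_localMap hN.smooth p
  have hpos := localMap_pos hx p
  have hq : x ((chartAt (EuclideanSpace ℝ (Fin 2)) p).symm u) 2 ≠ 0 :=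
    (hx.mem_upperHalfSpace _).ne'
  have hn : ∀ i, differential (normalGaussMap x N) _ (w i)
      = pderiv i (leftTranslate (localMap x p) (localMap N p)) u := by
    intro i
    rw [hw _ (contMDiff_normalGaussMap hx hN)]
    congr 1
    funext z
    exact normalGaussMap_eq x N _
  refine ⟨w, hspan, fun i j => ⟨?_, ?_, ?_⟩⟩
  · rw [← firstFormCoeff_eq, firstForm, hw x hx.smooth, hw x hx.smooth]
    rfl
  · have hnor := hN.normal _ (w i)
    rw [secondCoeff, minkowski_covFrame_normal hU hF hpos (contDiffOn_localNormal hx hN p)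
      (fun z hz => minkowski_localNormal_frame hx hN p hz) i j hu,
      pderiv_leftTranslate hU hF hpos hNf i hu]
    rw [metric, div_eq_zero_iff] at hnor
    -- Orthogonality of dx(w_i) and N removes the e₃ term of the covariant derivative.
    have hni := hnor.resolve_right (pow_ne_zero 2 hq)
    rw [secondForm, covDeriv_eq hq, metric, hni]
    rw [hw x hx.smooth, hw N hN.smooth, hw x hx.smooth]
    simp only [frame, leftTranslate, minkowski, localMap, Function.comp_apply, PiLp.add_apply,
      PiLp.sub_apply, PiLp.smul_apply, smul_eq_mul]
    field_simp
    ring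
  · rw [fourthForm, hn, hn, fourthCoeff]

lemma det_inducedCoeff_neg (hx : IsTimelikeImmersion x) (hN : IsUnitNormal x N) (p : M)
    {u : EuclideanSpace ℝ (Fin 2)} (hu : u ∈ (chartAt (EuclideanSpace ℝ (Fin 2)) p).target) :
    (inducedCoeff (localMap x p) u).det < 0 := by
  obtain ⟨w, hspan, hw⟩ := exists_basis_forms hx hN p hu
  obtain ⟨⟨v, hv⟩, v', hv'⟩ := hx.lorentzian ((chartAt (EuclideanSpace ℝ (Fin 2)) p).symm u)
  obtain ⟨a, b, rfl⟩ := hspan v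
  obtain ⟨c, d, rfl⟩ := hspan v'
  simp only [firstForm_lincomb, (hw _ _).1] at hv hv'
  rw [det_inducedCoeff]
  rw [inducedCoeff_comm _ _ 1 0] at hv hv'
  by_contra hcon
  -- For the quadratic form q with polar form B, q(v) q(v') - B(v, v')² = det g · (ad - bc)². A
  -- nonnegative determinant would make q(v) q(v') nonnegative, although the two values have
  -- opposite signs.
  have h1 := mul_neg_of_neg_of_pos hv hv'
  have h2 := mul_nonneg (not_lt.1 hcon) (sq_nonneg (a * d - b * c))
  nlinarith [sq_nonneg (a * c * inducedCoeff (localMap x p) u 0 0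
    + (a * d + b * c) * inducedCoeff (localMap x p) u 0 1
    + b * d * inducedCoeff (localMap x p) u 1 1)]

lemma secondCoeff_comm (hx : IsTimelikeImmersion x) (p : M)
    {u : EuclideanSpace ℝ (Fin 2)} (hu : u ∈ (chartAt (EuclideanSpace ℝ (Fin 2)) p).target) :
    secondCoeff x N p u 1 0 = secondCoeff x N p u 0 1 := by
  have h := frame₂_comm (chartAt (EuclideanSpace ℝ (Fin 2)) p).open_target
    (contDiffOn_localMap hx.smooth p) 1 0 hu
  rw [secondCoeff, secondCoeff]
  congr 1
  rw [covFrame, covFrame, minkowski_comm (frame (localMap x p) 1 u) (frame (localMap x p) 0 u)]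
  erw [h]
  congr 1
  exact sub_right_comm _ _ _

lemma fourthCoeff_eq (hx : IsTimelikeImmersion x) (hN : IsUnitNormal x N) (p : M)
    {u : EuclideanSpace ℝ (Fin 2)} (hu : u ∈ (chartAt (EuclideanSpace ℝ (Fin 2)) p).target)
    (i j : Fin 2) :
    (inducedCoeff (localMap x p) u 0 0 * inducedCoeff (localMap x p) u 1 1
        - inducedCoeff (localMap x p) u 0 1 ^ 2) * fourthCoeff x N p u i j
      = (inducedCoeff (localMap x p) u 1 1 * secondCoeff x N p u 0 0
          - 2 * inducedCoeff (localMap x p) u 0 1 * secondCoeff x N p u 0 1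
          + inducedCoeff (localMap x p) u 0 0 * secondCoeff x N p u 1 1
          - 2 * gaussHeight x N p u * (inducedCoeff (localMap x p) u 0 0
            * inducedCoeff (localMap x p) u 1 1 - inducedCoeff (localMap x p) u 0 1 ^ 2))
          * secondCoeff x N p u i j
        + (gaussHeight x N p u ^ 2 * (inducedCoeff (localMap x p) u 0 0
            * inducedCoeff (localMap x p) u 1 1 - inducedCoeff (localMap x p) u 0 1 ^ 2)
          - (secondCoeff x N p u 0 0 * secondCoeff x N p u 1 1 - secondCoeff x N p u 0 1 ^ 2))
          * inducedCoeff (localMap x p) u i j := by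
  have hU := (chartAt (EuclideanSpace ℝ (Fin 2)) p).open_target
  have hF := contDiffOn_localMap hx.smooth p
  have hn := contDiffOn_localNormal hx hN p
  have hnE := fun i => minkowski_localNormal_frame hx hN p hu i
  have hII : ∀ i j, minkowski (pderiv i (leftTranslate (localMap x p) (localMap N p)) u)
      (frame (localMap x p) j u)
      = -(secondCoeff x N p u i j - gaussHeight x N p u * inducedCoeff (localMap x p) u i j) := by
    intro i j
    rw [secondCoeff, minkowski_covFrame_normal hU hF (localMap_pos hx p) hn
      (fun z hz => minkowski_localNormal_frame hx hN p hz) i j hu, gaussHeight,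
      inducedCoeff_apply]
    ring
  -- From ⟨n, n⟩ = 1: the derivatives of n are tangential, so the normal term of `minkowski_expand`
  -- drops out.
  have hort : ∀ i, minkowski (pderiv i (leftTranslate (localMap x p) (localMap N p)) u)
      (leftTranslate (localMap x p) (localMap N p) u) = 0 := by
    intro i
    have hd := differentiableAt_of_contDiffOn hU hn hu
    have h := pderiv_congr hU
      (fun z _ => minkowski_localNormal_self hN p z) i hu
    rw [pderiv_minkowski hd hd, pderiv_const, minkowski_comm
      (leftTranslate (localMap x p) (localMap N p) u)] at h
    linarith
  apply fourth_cayley_hamilton (fun i j => inducedCoeff (localMap x p) u i j)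
    (secondCoeff x N p u) (fourthCoeff x N p u) (gaussHeight x N p u)
    (inducedCoeff_comm _ _ 1 0) (secondCoeff_comm hx p hu)
  intro i j
  have h := minkowski_expand (pderiv i (leftTranslate (localMap x p) (localMap N p)) u)
    (pderiv j (leftTranslate (localMap x p) (localMap N p)) u)
    (frame (localMap x p) 0 u) (frame (localMap x p) 1 u) _
    (minkowski_localNormal_self hN p u) (hnE 0) (hnE 1)
  simp only [hII, hort, ← inducedCoeff_apply] at h
  rw [fourthCoeff]
  linear_combination h

/-- At a point that is not umbilic, the normal Gauss map is conformal if and only if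
`det II = η₃² det I`, and the conformal factor is then determined. -/
lemma conformal_at_iff (hx : IsTimelikeImmersion x) (hN : IsUnitNormal x N) (p : M)
    {u : EuclideanSpace ℝ (Fin 2)} (hu : u ∈ (chartAt (EuclideanSpace ℝ (Fin 2)) p).target)
    (humb : ¬ IsUmbilic x N ((chartAt (EuclideanSpace ℝ (Fin 2)) p).symm u)) (r : ℝ) :
    (∀ v w : TangentSpace (𝓡 2) ((chartAt (EuclideanSpace ℝ (Fin 2)) p).symm u),
        fourthForm x N _ v w = r * secondForm x N _ v w) ↔
      secondCoeff x N p u 0 0 * secondCoeff x N p u 1 1 - secondCoeff x N p u 0 1 ^ 2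
        = gaussHeight x N p u ^ 2 * (inducedCoeff (localMap x p) u).det ∧
      r = (inducedCoeff (localMap x p) u 1 1 * secondCoeff x N p u 0 0
          - 2 * inducedCoeff (localMap x p) u 0 1 * secondCoeff x N p u 0 1
          + inducedCoeff (localMap x p) u 0 0 * secondCoeff x N p u 1 1)
          / (inducedCoeff (localMap x p) u).det - 2 * gaussHeight x N p u := by
  obtain ⟨w, hspan, hw⟩ := exists_basis_forms hx hN p hu
  have hq : x ((chartAt (EuclideanSpace ℝ (Fin 2)) p).symm u) 2 ≠ 0 :=
    (hx.mem_upperHalfSpace _).ne'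
  have hd := (det_inducedCoeff_neg hx hN p hu).ne
  have hk := fourthCoeff_eq hx hN p hu
  have humb' : ¬ ∃ c : ℝ, ∀ i j, secondCoeff x N p u i j
      = c * inducedCoeff (localMap x p) u i j := by
    rintro ⟨c, hc⟩
    refine humb ⟨c, fun v v' => ?_⟩
    obtain ⟨a, b, rfl⟩ := hspan v
    obtain ⟨a', b', rfl⟩ := hspan v'
    simp only [firstForm_lincomb, secondForm_lincomb hq, hw, hc]
    ring
  have hbasis : (∀ v w : TangentSpace (𝓡 2) ((chartAt (EuclideanSpace ℝ (Fin 2)) p).symm u),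
      fourthForm x N _ v w = r * secondForm x N _ v w) ↔
      ∀ i j, fourthCoeff x N p u i j = r * secondCoeff x N p u i j := by
    constructor
    · intro h i j
      rw [← (hw i j).2.1, ← (hw i j).2.2, h]
    · intro h v v'
      obtain ⟨a, b, rfl⟩ := hspan v
      obtain ⟨a', b', rfl⟩ := hspan v'
      simp only [fourthForm_lincomb, secondForm_lincomb hq, hw, h]
      ring
  rw [hbasis]
  rw [det_inducedCoeff] at hd ⊢
  constructor
  · intro h
    have hH := det_second_eq_of_conformal (fun i j => inducedCoeff (localMap x p) u i j)
      (secondCoeff x N p u) (fourthCoeff x N p u) (gaussHeight x N p u) r hd hk humb' h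
    refine ⟨hH, ?_⟩
    by_contra hr
    -- If `r` differed from the forced value, II would vanish, and a zero of II is an umbilic with
    -- factor 0.
    refine humb' ⟨0, fun i j => ?_⟩
    have hkij := hk i j
    rw [hH, h i j, sub_self, zero_mul, add_zero] at hkij
    by_contra hne
    rw [zero_mul] at hne
    rw [← mul_assoc] at hkij
    have := mul_right_cancel₀ hne hkij
    apply hr
    rw [eq_sub_iff_add_eq, eq_div_iff hd]
    linear_combination this
  · rintro ⟨hH, hr⟩ i j
    have hkij := hk i j
    rw [hH, sub_self, zero_mul, add_zero] at hkij
    rw [eq_sub_iff_add_eq, eq_div_iff hd] at hr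
    apply mul_left_cancel₀ hd
    rw [hkij]
    linear_combination (-secondCoeff x N p u i j) * hr

lemma gaussCurvature_eq (hx : IsTimelikeImmersion x) (hN : IsUnitNormal x N) (p : M) :
    gaussCurvature x p = 1
      + (secondCoeff x N p (chartAt (EuclideanSpace ℝ (Fin 2)) p p) 0 0
          * secondCoeff x N p (chartAt (EuclideanSpace ℝ (Fin 2)) p p) 1 1
          - secondCoeff x N p (chartAt (EuclideanSpace ℝ (Fin 2)) p p) 0 1 ^ 2)
        / (inducedCoeff (localMap x p) (chartAt (EuclideanSpace ℝ (Fin 2)) p p)).det := by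
  have hu := mem_chart_target (EuclideanSpace ℝ (Fin 2)) p
  rw [gaussCurvature, firstFormCoeff_eq]
  exact gaussCurvatureCoord_inducedCoeff (chartAt (EuclideanSpace ℝ (Fin 2)) p).open_target
    (contDiffOn_localMap hx.smooth p) (localMap_pos hx p)
    (fun z hz => (det_inducedCoeff_neg hx hN p hz).ne) hu
    (minkowski_localNormal_self hN p _) (fun i => minkowski_localNormal_frame hx hN p hu i)

/-- The Gauss curvature condition in terms of the second fundamental form. -/
lemma gaussCurvature_eq_iff (hx : IsTimelikeImmersion x) (hN : IsUnitNormal x N) (p : M) :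
    gaussCurvature x p = 1 + (normalGaussMap x N p 2) ^ 2 ↔
      secondCoeff x N p (chartAt (EuclideanSpace ℝ (Fin 2)) p p) 0 0
          * secondCoeff x N p (chartAt (EuclideanSpace ℝ (Fin 2)) p p) 1 1
          - secondCoeff x N p (chartAt (EuclideanSpace ℝ (Fin 2)) p p) 0 1 ^ 2
        = gaussHeight x N p (chartAt (EuclideanSpace ℝ (Fin 2)) p p) ^ 2
          * (inducedCoeff (localMap x p) (chartAt (EuclideanSpace ℝ (Fin 2)) p p)).det := by
  rw [gaussCurvature_eq hx hN, add_right_inj, gaussHeight_chartAt,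
    div_eq_iff (det_inducedCoeff_neg hx hN p (mem_chart_target _ p)).ne]

/-- The conformal factor in the chart at `p`. -/
noncomputable def conformalFactor (x N : M → EuclideanSpace ℝ (Fin 3)) (p : M)
    (u : EuclideanSpace ℝ (Fin 2)) : ℝ :=
  (inducedCoeff (localMap x p) u 1 1 * secondCoeff x N p u 0 0
    - 2 * inducedCoeff (localMap x p) u 0 1 * secondCoeff x N p u 0 1
    + inducedCoeff (localMap x p) u 0 0 * secondCoeff x N p u 1 1)
    / (inducedCoeff (localMap x p) u).det - 2 * gaussHeight x N p u

lemma contDiffOn_conformalFactor (hx : IsTimelikeImmersion x) (hN : IsUnitNormal x N) (p : M) :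
    ContDiffOn ℝ ∞ (conformalFactor x N p) (chartAt (EuclideanSpace ℝ (Fin 2)) p).target := by
  have hU := (chartAt (EuclideanSpace ℝ (Fin 2)) p).open_target
  have hF := contDiffOn_localMap hx.smooth p
  have hpos := localMap_pos hx p
  have hn := contDiffOn_localNormal hx hN p
  have hg := contDiffOn_inducedCoeff hU hF hpos
  have hE := contDiffOn_frame hU hF hpos
  have hII : ∀ i j, ContDiffOn ℝ ∞ (fun u => secondCoeff x N p u i j)
      (chartAt (EuclideanSpace ℝ (Fin 2)) p).target := by
    intro i j
    refine ((contDiffOn_minkowski (contDiffOn_pderiv hU hn i) (hE j)).neg.add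
      ((contDiffOn_euclidean.1 hn 2).mul (contDiffOn_minkowski (hE i) (hE j)))).congr
      fun u hu => ?_
    exact minkowski_covFrame_normal hU hF hpos hn
      (fun z hz => minkowski_localNormal_frame hx hN p hz) i j hu
  have hdet : ContDiffOn ℝ ∞ (fun u => (inducedCoeff (localMap x p) u).det)
      (chartAt (EuclideanSpace ℝ (Fin 2)) p).target := by
    simp only [det_inducedCoeff]
    exact ((hg 0 0).mul (hg 1 1)).sub ((hg 0 1).pow 2)
  exact (((((hg 1 1).mul (hII 0 0)).sub ((contDiffOn_const.mul (hg 0 1)).mul (hII 0 1))).add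
    ((hg 0 0).mul (hII 1 1))).div hdet fun u hu => (det_inducedCoeff_neg hx hN p hu).ne).sub
    (contDiffOn_const.mul (contDiffOn_euclidean.1 hn 2))

/-- Since II is nowhere zero, ρ is determined pointwise and coincides near each point with the
smooth `conformalFactor` of a chart. -/
lemma contMDiff_of_conformal (hx : IsTimelikeImmersion x) (hN : IsUnitNormal x N)
    (humb : ∀ p, ¬ IsUmbilic x N p) (ρ : M → ℝ)
    (hρ : ∀ p (v w : TangentSpace (𝓡 2) p), fourthForm x N p v w = ρ p * secondForm x N p v w) :
    ContMDiff (𝓡 2) 𝓘(ℝ, ℝ) ∞ ρ := by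
  intro p
  have h : ContMDiffOn (𝓡 2) 𝓘(ℝ, ℝ) ∞
      (conformalFactor x N p ∘ chartAt (EuclideanSpace ℝ (Fin 2)) p)
      (chartAt (EuclideanSpace ℝ (Fin 2)) p).source :=
    (contMDiffOn_iff_contDiffOn.2 (contDiffOn_conformalFactor hx hN p)).comp contMDiffOn_chart
      fun q hq => (chartAt (EuclideanSpace ℝ (Fin 2)) p).map_source hq
  refine ((h.congr fun q hq => ?_) p (mem_chart_source _ p)).contMDiffAt
    (chart_source_mem_nhds _ p)
  have hu := (chartAt (EuclideanSpace ℝ (Fin 2)) p).map_source hq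
  have hc := ((conformal_at_iff hx hN p hu (humb _) _).1 (hρ _)).2
  rw [(chartAt (EuclideanSpace ℝ (Fin 2)) p).left_inv hq] at hc
  exact hc

end Main

end DeSitter

theorem theorem7p1 {M : Type*} [TopologicalSpace M]
    [ChartedSpace (EuclideanSpace ℝ (Fin 2)) M] [IsManifold (𝓡 2) ∞ M]
    (x N : M → EuclideanSpace ℝ (Fin 3))
    (hx : DeSitter.IsTimelikeImmersion x)
    (hN : DeSitter.IsUnitNormal x N)
    (humb : ∀ p, ¬ DeSitter.IsUmbilic x N p) :
    DeSitter.IsConformalNormalGaussMap x N ↔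
      ∀ p, DeSitter.gaussCurvature x p = 1 + (DeSitter.normalGaussMap x N p 2) ^ 2 := by
  constructor
  · rintro ⟨ρ, -, hρ⟩ p
    rw [DeSitter.gaussCurvature_eq_iff hx hN]
    exact ((DeSitter.conformal_at_iff hx hN p (mem_chart_target _ p) (humb _) _).1 (hρ _)).1
  · intro hK
    have hex : ∀ p, ∃ r : ℝ, ∀ v w : TangentSpace (𝓡 2) p,
        DeSitter.fourthForm x N p v w = r * DeSitter.secondForm x N p v w := by
      intro p
      have h := (DeSitter.conformal_at_iff hx hN p (mem_chart_target _ p) (humb _) _).2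
        ⟨(DeSitter.gaussCurvature_eq_iff hx hN p).1 (hK p), rfl⟩
      -- The pointwise criterion lives at the image of the chart value under the inverse chart; this
      -- moves it to `p`.
      rw [(chartAt (EuclideanSpace ℝ (Fin 2)) p).left_inv (mem_chart_source _ p)] at h
      exact ⟨_, h⟩
    choose ρ hρ using hex
    exact ⟨ρ, DeSitter.contMDiff_of_conformal hx hN humb ρ hρ, hρ⟩
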